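/- Theorem (Closure reliability for a heterogeneous pair). Let $\mathbb S$ be a finite, linearly ordered universe of ground atoms with a proof system, i.e. a single-step derivability relation that is monotone in its set of premises; let $T(\Gamma)=\Gamma\cup\{s:\Gamma\vdash^1 s\}$ and $\mathrm{Cn}(\Gamma)=\bigcup_{n\ge 0}T^n(\Gamma)$. For $S\subseteq\mathbb S$ the irredundant core $\mathrm{Atom}(S)$ is obtained by starting with $A=S$, scanning $S$ in increasing order and deleting $s$ from $A$ whenever $s\in\mathrm{Cn}(A\setminus\{s\})$. For a base $\Gamma$, the closure distortion $d_{\mathrm{Cn}}(s,\hat s\mid\Gamma)$ is the Jaccard distance between $\mathrm{Cn}((\Gamma\setminus\{s\})\cup\{s\})$ and $\mathrm{Cn}((\Gamma\setminus\{s\})\cup\{\hat s\})$; the closure fidelity is $\mathsf F_{\mathrm{Cn}}(S,\hat S)=|\mathrm{Cn}(S)\cap\mathrm{Cn}(\hat S)|/|\mathrm{Cn}(S)\cup\mathrm{Cn}(\hat S)|$, with $0/0:=1$. Let $S^{(i)},S^{(j)}\subseteq\mathbb S$ be the knowledge bases of sender $i$ and receiver $j$, with $S^{(j)}\ne\varnothing$,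 and put $A^{(i)}=\mathrm{Atom}(S^{(i)})$. Let $W_{ij}$ be a Markov kernel between finite alphabets $S_C,\hat S_C$, with Shannon capacity $C(W_{ij})>0$ (logarithms are to base $2$, and $\log 0:=0$). A code of length $n$ with message set $S^{(i)}$ consists of an encoder $f_n:S^{(i)}\to S_C^n$ and a decoder $g_n:\hat S_C^n\to S^{(j)}$; its closure error is $$P^{(n)}_{e,\mathrm{Cn}}=\max_{m\in S^{(i)}}\Pr\bigl[d_{\mathrm{Cn}}(m,g_n(\hat{\mathsf S}_c^n)\mid S^{(i)})>0\bigr],$$ where $\hat{\mathsf S}_c^n$ is the output of the memoryless channel $W_{ij}^{\otimes n}$ on input $f_n(m)$ (and the maximum is $0$ if $S^{(i)}=\varnothing$). The code is two-layer if $g_n$ takes values in $A^{(i)}$ and there is $a_0\in A^{(i)}$ with $f_n(m)=f_n(a_0)$ for all $m\in S^{(i)}\setminus A^{(i)}$. Assume (H1) $A^{(i)}\subseteq S^{(j)}$ and (H2) $S^{(j)}\setminus S^{(i)}\subseteq\mathrm{Cn}(S^{(i)})$. Then: (i) $\mathsf F_{\mathrm{Cn}}(S^{(i)},S^{(j)})=1$.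 (ii) There is a sequence of codes, one for each length $n$, with message set $S^{(i)}$ and outputs in $S^{(j)}$, such that $P^{(n)}_{e,\mathrm{Cn}}\to 0$ as $n\to\infty$. If $A^{(i)}\neq\varnothing$, these codes can be taken two-layer. Moreover the error vanishes at every rate $\log|A^{(i)}|/n$ below capacity, uniformly: for all $R<C(W_{ij})$ and $\delta>0$ there is $N$, depending only on $W_{ij}$, $R$ and $\delta$, such that for every $n\ge N$ and every universe, proof system and pair of knowledge bases as above satisfying (H1), (H2) and $\log|A^{(i)}|/n\le R$ there is such a code (two-layer if $A^{(i)}\ne\varnothing$) of length $n$ with $P^{(n)}_{e,\mathrm{Cn}}\le\delta$. (iii) Suppose in addition that for distinct $a_1,a_2\in A^{(i)}$ no $\hat s\in S^{(j)}$ satisfies $d_{\mathrm{Cn}}(a_1,\hat s\mid S^{(i)})=0=d_{\mathrm{Cn}}(a_2,\hat s\mid S^{(i)})$. Then for every $n$ and every $\epsilon<1$, every code of length $n$ with message set $S^{(i)}$, outputs in $S^{(j)}$ and $P^{(n)}_{e,\mathrm{Cn}}\le\epsilon$ satisfies $$\log|A^{(i)}|\le\frac{nC(W_{ij})+1}{1-\epsilon}.$$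 -/

import Mathlib

open Filter Topology

universe u v w

noncomputable section

namespace SemComm

/-! ### Proof system, deductive closure, irredundant core -/

/-- A proof system over a universe `U` of ground atoms, given by its single-step derivability
relation, which is monotone in the premises. -/
structure ProofSystem (U : Type*) where
  /-- `Step Γ s`: the atom `s` is derivable from the premises `Γ` in one step. -/
  Step : Set U → U → Prop
  mono : ∀ {Γ Δ : Set U} {s : U}, Γ ⊆ Δ → Step Γ s → Step Δ s

/-- The immediate consequence operator `T(Γ) = Γ ∪ {s | Γ ⊢¹ s}`. -/
def ProofSystem.T {U : Type*} (PS : ProofSystem U) (Γ : Set U) : Set U :=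
  Γ ∪ {s | PS.Step Γ s}

/-- The deductive closure `Cn(Γ) = ⋃ₙ Tⁿ(Γ)`. -/
def ProofSystem.Cn {U : Type*} (PS : ProofSystem U) (Γ : Set U) : Set U :=
  ⋃ n : ℕ, PS.T^[n] Γ

open Classical in
/-- One step of the scan that extracts the core: `s` is deleted from the current set `A` when it
is derivable from the rest of `A`. -/
def ProofSystem.scanStep {U : Type*} (PS : ProofSystem U) (A : Finset U) (s : U) : Finset U :=
  if s ∈ PS.Cn ((A : Set U) \ {s}) then A.erase s else A

/-- The irredundant core `Atom(S)`: start from `S`, scan the elements of `S` in the canonical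
(increasing) order and delete those that are derivable from the remaining ones. -/
def ProofSystem.core {U : Type*} [LinearOrder U] (PS : ProofSystem U) (S : Finset U) : Finset U :=
  (S.sort (· ≤ ·)).foldl PS.scanStep S

/-! ### Overlap decomposition of a sender `Si` and a receiver `Sj` -/

/-- Lost core `A⁽ⁱ⁾ \ S⁽ʲ⁾`. -/
def ProofSystem.lostCore {U : Type*} [LinearOrder U] (PS : ProofSystem U) (Si Sj : Finset U) :
    Finset U :=
  PS.core Si \ Sj

/-- Surplus states `S⁽ʲ⁾ \ S⁽ⁱ⁾`. -/
def surplus {U : Type*} [LinearOrder U] (Si Sj : Finset U) : Finset U :=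
  Sj \ Si

/-- Non-derivable surplus `(S⁽ʲ⁾ \ S⁽ⁱ⁾) \ Cn(S⁽ⁱ⁾)`. -/
def ProofSystem.nonDerivableSurplus {U : Type*} [LinearOrder U] (PS : ProofSystem U)
    (Si Sj : Finset U) : Set U :=
  (surplus Si Sj : Set U) \ PS.Cn (Si : Set U)

/-! ### Closure fidelity and closure distortion -/

open Classical in
/-- The Jaccard index `|C ∩ D| / |C ∪ D|` of two subsets of a finite type, with `0 / 0 := 1`. -/
def jaccard {U : Type*} (C D : Set U) : ℝ :=
  if C ∪ D = ∅ then 1 else ((C ∩ D).ncard : ℝ) / ((C ∪ D).ncard : ℝ)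

/-- Closure fidelity: the Jaccard index of the two deductive closures. -/
def ProofSystem.closureFidelity {U : Type*} (PS : ProofSystem U) (S S' : Finset U) : ℝ :=
  jaccard (PS.Cn (S : Set U)) (PS.Cn (S' : Set U))

/-- Closure distortion `d_Cn(s, s' | Γ)`: the Jaccard distance between
`Cn((Γ \ {s}) ∪ {s})` and `Cn((Γ \ {s}) ∪ {s'})`. -/
def ProofSystem.closureDistortion {U : Type*} (PS : ProofSystem U) (Γ : Finset U) (s s' : U) : ℝ :=
  1 - jaccard (PS.Cn (((Γ : Set U) \ {s}) ∪ {s})) (PS.Cn (((Γ : Set U) \ {s}) ∪ {s'}))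

/-- The acceptable set `R_Cn(m)`: the elements of the output space `V` with zero closure distortion
from `m`, relative to `Γ`. -/
def ProofSystem.acceptable {U : Type*} (PS : ProofSystem U) (Γ V : Finset U) (m : U) : Set U :=
  {v | v ∈ V ∧ PS.closureDistortion Γ m v = 0}

/-- Deductive independence of the core of `Γ`, with output space `V`: distinct core elements have
disjoint acceptable sets. -/
def ProofSystem.CoreDisjoint {U : Type*} [LinearOrder U] (PS : ProofSystem U) (Γ V : Finset U) :
    Prop :=
  ∀ a₁ ∈ PS.core Γ, ∀ a₂ ∈ PS.core Γ, a₁ ≠ a₂ →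
    Disjoint (PS.acceptable Γ V a₁) (PS.acceptable Γ V a₂)

/-! ### Channels and capacity -/

/-- A Markov kernel from `X` to the finite type `Y`. -/
structure MarkovKernel (X Y : Type*) [Fintype Y] where
  prob : X → Y → ℝ
  nonneg : ∀ x y, 0 ≤ prob x y
  sum_eq_one : ∀ x, ∑ y, prob x y = 1

/-- The `n`-fold memoryless extension `W^{⊗n}(y | x) = ∏ₖ W(yₖ | xₖ)`. -/
def MarkovKernel.memoryless {X Y : Type*} [Fintype Y] (W : MarkovKernel X Y) {n : ℕ}
    (x : Fin n → X) (y : Fin n → Y) : ℝ :=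
  ∏ k, W.prob (x k) (y k)

/-- Mutual information, in bits, of a joint distribution `P` on `X × Y`
(terms with `P x y = 0` contribute `0`). -/
def mutualInfo {X Y : Type*} [Fintype X] [Fintype Y] (P : X → Y → ℝ) : ℝ :=
  ∑ x, ∑ y, P x y * Real.logb 2 (P x y / ((∑ y', P x y') * ∑ x', P x' y))

/-- Shannon capacity `C(W)`, in bits: the maximum over input distributions `p` of the mutual
information of the joint distribution `p(x) W(y | x)`. -/
def MarkovKernel.capacity {X Y : Type*} [Fintype X] [Fintype Y] (W : MarkovKernel X Y) : ℝ :=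
  ⨆ p : stdSimplex ℝ X, mutualInfo fun x y => (p : X → ℝ) x * W.prob x y

/-! ### Semantic block codes -/

/-- A semantic block code of length `n` with message set `M` and output space `V`; its number of
messages is `M.card`. -/
structure BlockCode {U : Type*} (n : ℕ) (X Y : Type*) (M V : Finset U) where
  enc : M → Fin n → X
  dec : (Fin n → Y) → V

open Classical in
/-- Closure error probability: the maximum over the messages `m` of the probability, when `m` is
sent over `W^{⊗n}`, that the reconstruction has positive closure distortion from `m`, relative to
the base `Γ`. -/
def BlockCode.closureError {U X Y : Type*} [Fintype Y] {n : ℕ} {M V : Finset U}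
    (c : BlockCode n X Y M V) (PS : ProofSystem U) (Γ : Finset U) (W : MarkovKernel X Y) : ℝ :=
  ⨆ m : M, ∑ y : Fin n → Y,
    if 0 < PS.closureDistortion Γ m (c.dec y) then W.memoryless (c.enc m) y else 0

/-- Two-layer code for a core `A`: the decoder outputs elements of `A` only, and every message
outside `A` is sent as one and the same core element `a₀`. -/
def BlockCode.IsTwoLayer {U X Y : Type*} {n : ℕ} {M V : Finset U}
    (c : BlockCode n X Y M V) (A : Finset U) : Prop :=
  (∀ y, (c.dec y : U) ∈ A) ∧
    ∃ a₀ : M, (a₀ : U) ∈ A ∧ ∀ m : M, (m : U) ∉ A → c.enc m = c.enc a₀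

end SemComm

end

namespace SemComm

/-! ### Deductive closure and core -/

/-! The scan deletes an atom only when the remaining ones derive it, so the core generates the same
closure as the base. With (H1) and (H2), each base lies in the closure of the other, which gives
(i). Replacing a non-core atom by any consequence of the base leaves the core in place and costs no
closure (`closureDistortion_eq_zero_of_notMem_core`). Non-core messages therefore need no channel
use, and only the core atoms have to be distinguished at the receiver.

Achievability is thus ordinary channel coding for |A| messages. Feinstein's greedy construction
(`exists_codebook`) bounds the maximal error by the probability of low information density plus
|A|/t. A Chernoff bound makes the first term exponentially small, and t = 2^(nγ), with γ strictly
between the rate and a mutual information, does so for the second. Neither bound sees the logical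
data, whence the uniformity.

For the converse, disjoint acceptable sets turn any semantic code into a channel code for the core
with disjoint decoding sets. Fano's bound for such codes is proved by Gibbs' inequality against the
product of the letterwise output distributions. -/

theorem ProofSystem.T_mono {U : Type*} (PS : ProofSystem U) : Monotone PS.T :=
  fun _ _ h _ hs => hs.imp (fun hm => h hm) (PS.mono h)

theorem ProofSystem.subset_T {U : Type*} (PS : ProofSystem U) (Γ : Set U) : Γ ⊆ PS.T Γ :=
  Set.subset_union_left

theorem ProofSystem.subset_Cn {U : Type*} (PS : ProofSystem U) (Γ : Set U) : Γ ⊆ PS.Cn Γ :=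
  Set.subset_iUnion (fun n => PS.T^[n] Γ) 0

theorem ProofSystem.Cn_mono {U : Type*} (PS : ProofSystem U) : Monotone PS.Cn :=
  fun _ _ h => Set.iUnion_mono fun n => PS.T_mono.iterate n h

/-- The iterates of `T` increase in a finite powerset, so they stabilise, and the closure is one of
them. Finiteness of the universe stands in for finitary derivations. -/
theorem ProofSystem.T_Cn {U : Type*} [Finite U] (PS : ProofSystem U) (Γ : Set U) :
    PS.T (PS.Cn Γ) = PS.Cn Γ := by
  have hmono : Monotone fun n => PS.T^[n] Γ :=
    Monotone.monotone_iterate_of_le_map PS.T_mono (PS.subset_T Γ)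
  obtain ⟨N, hN⟩ := WellFoundedGT.monotone_chain_condition ⟨_, hmono⟩
  have hCn : PS.Cn Γ = PS.T^[N] Γ := by
    refine Set.Subset.antisymm (Set.iUnion_subset fun n => ?_)
      (Set.subset_iUnion (fun n => PS.T^[n] Γ) N)
    rcases le_total n N with h | h
    · exact hmono h
    · exact (hN n h).ge
  refine Set.Subset.antisymm ?_ (PS.subset_T _)
  have hT : PS.T (PS.Cn Γ) = PS.T^[N + 1] Γ := by rw [hCn, Function.iterate_succ_apply']
  rw [hT]
  exact Set.subset_iUnion (fun n => PS.T^[n] Γ) (N + 1)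

theorem ProofSystem.Cn_subset_of_subset_Cn {U : Type*} [Finite U] (PS : ProofSystem U)
    {Γ Δ : Set U} (h : Δ ⊆ PS.Cn Γ) : PS.Cn Δ ⊆ PS.Cn Γ :=
  (PS.Cn_mono h).trans <| Set.iUnion_subset fun n =>
    (Function.iterate_fixed (PS.T_Cn Γ) n).subset

theorem ProofSystem.scanStep_subset {U : Type*} (PS : ProofSystem U) (A : Finset U) (s : U) :
    PS.scanStep A s ⊆ A := by
  classical
  unfold ProofSystem.scanStep
  split_ifs
  · exact Finset.erase_subset _ _
  · exact subset_rfl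

theorem ProofSystem.subset_Cn_scanStep {U : Type*} (PS : ProofSystem U)
    (A : Finset U) (s : U) : (A : Set U) ⊆ PS.Cn (PS.scanStep A s : Set U) := by
  classical
  unfold ProofSystem.scanStep
  split_ifs with h
  · intro a ha
    rw [Finset.coe_erase]
    by_cases has : a = s
    · exact has ▸ h
    · exact PS.subset_Cn _ ⟨ha, has⟩
  · exact PS.subset_Cn _

/-- Each deletion preserves the closure, and idempotence of `Cn` chains the deletions. The starting
set is quantified because it changes along the scan. -/
theorem ProofSystem.foldl_scanStep_spec {U : Type*} [Finite U] (PS : ProofSystem U) (l : List U) :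
    ∀ A : Finset U, l.foldl PS.scanStep A ⊆ A ∧
      (A : Set U) ⊆ PS.Cn ((l.foldl PS.scanStep A : Finset U) : Set U) := by
  induction l with
  | nil => exact fun A => ⟨subset_rfl, PS.subset_Cn _⟩
  | cons s l ih =>
    intro A
    obtain ⟨h1, h2⟩ := ih (PS.scanStep A s)
    exact ⟨h1.trans (PS.scanStep_subset A s),
      (PS.subset_Cn_scanStep A s).trans (PS.Cn_subset_of_subset_Cn h2)⟩

theorem ProofSystem.core_subset {U : Type*} [Finite U] [LinearOrder U] (PS : ProofSystem U)
    (S : Finset U) : PS.core S ⊆ S :=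
  (PS.foldl_scanStep_spec _ S).1

theorem ProofSystem.subset_Cn_core {U : Type*} [Finite U] [LinearOrder U] (PS : ProofSystem U)
    (S : Finset U) : (S : Set U) ⊆ PS.Cn (PS.core S : Set U) :=
  (PS.foldl_scanStep_spec _ S).2

/-! ### Fidelity and distortion -/

theorem jaccard_self {U : Type*} [Finite U] (C : Set U) : jaccard C C = 1 := by
  unfold jaccard
  split_ifs with h
  · rfl
  · rw [Set.union_self] at h
    rw [Set.union_self, Set.inter_self, div_self]
    exact_mod_cast ((Set.ncard_pos (Set.toFinite C)).2 (Set.nonempty_iff_ne_empty.2 h)).ne'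

theorem jaccard_le_one {U : Type*} [Finite U] (C D : Set U) : jaccard C D ≤ 1 := by
  unfold jaccard
  split_ifs with h
  · rfl
  · refine div_le_one_of_le₀ ?_ (Nat.cast_nonneg _)
    exact_mod_cast Set.ncard_le_ncard (Set.inter_subset_left.trans Set.subset_union_left)

theorem ProofSystem.closureDistortion_nonneg {U : Type*} [Finite U] (PS : ProofSystem U)
    (Γ : Finset U) (s s' : U) : 0 ≤ PS.closureDistortion Γ s s' :=
  sub_nonneg.2 (jaccard_le_one _ _)

theorem ProofSystem.closureDistortion_self {U : Type*} [Finite U] (PS : ProofSystem U)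
    (Γ : Finset U) (s : U) : PS.closureDistortion Γ s s = 0 := by
  rw [closureDistortion, jaccard_self, sub_self]

/-- Replacing an element of `Γ` outside the core by a consequence of `Γ` costs no closure. -/
theorem ProofSystem.closureDistortion_eq_zero_of_notMem_core {U : Type*} [Finite U]
    [LinearOrder U] (PS : ProofSystem U) {Γ : Finset U} {s s' : U} (hs : s ∈ Γ)
    (hsc : s ∉ PS.core Γ) (hs' : s' ∈ PS.Cn (Γ : Set U)) :
    PS.closureDistortion Γ s s' = 0 := by
  have hΓ : ((Γ : Set U) \ {s}) ∪ {s} = Γ :=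
    Set.sdiff_union_of_subset (Set.singleton_subset_iff.2 hs)
  have hcore : (PS.core Γ : Set U) ⊆ ((Γ : Set U) \ {s}) ∪ {s'} := fun a ha =>
    Or.inl ⟨PS.core_subset Γ ha, fun h => hsc (h ▸ ha)⟩
  have h : PS.Cn (Γ : Set U) = PS.Cn (((Γ : Set U) \ {s}) ∪ {s'}) := by
    refine Set.Subset.antisymm
      (PS.Cn_subset_of_subset_Cn ((PS.subset_Cn_core Γ).trans (PS.Cn_mono hcore)))
      (PS.Cn_subset_of_subset_Cn (Set.union_subset ?_ (Set.singleton_subset_iff.2 hs')))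
    exact Set.sdiff_subset.trans (PS.subset_Cn _)
  rw [closureDistortion, hΓ, ← h, jaccard_self, sub_self]

theorem ProofSystem.core_subset_of_lostCore_eq_empty {U : Type*} [LinearOrder U]
    {PS : ProofSystem U} {Si Sj : Finset U} (h : PS.lostCore Si Sj = ∅) : PS.core Si ⊆ Sj :=
  Finset.sdiff_eq_empty_iff_subset.1 h

theorem ProofSystem.subset_Cn_of_nonDerivableSurplus_eq_empty {U : Type*} [LinearOrder U]
    {PS : ProofSystem U} {Si Sj : Finset U} (h : PS.nonDerivableSurplus Si Sj = ∅) :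
    (Sj : Set U) ⊆ PS.Cn (Si : Set U) := by
  intro s hs
  by_cases hsi : s ∈ Si
  · exact PS.subset_Cn _ hsi
  · refine Set.sdiff_eq_empty.1 h ?_
    simpa [surplus] using And.intro hs hsi

theorem ProofSystem.closureFidelity_eq_one {U : Type*} [Finite U] [LinearOrder U]
    {PS : ProofSystem U} {Si Sj : Finset U} (h1 : PS.lostCore Si Sj = ∅)
    (h2 : PS.nonDerivableSurplus Si Sj = ∅) : PS.closureFidelity Si Sj = 1 := by
  have h : PS.Cn (Si : Set U) = PS.Cn (Sj : Set U) := by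
    refine Set.Subset.antisymm (PS.Cn_subset_of_subset_Cn ((PS.subset_Cn_core Si).trans
      (PS.Cn_mono ?_))) (PS.Cn_subset_of_subset_Cn ?_)
    · exact_mod_cast core_subset_of_lostCore_eq_empty h1
    · exact subset_Cn_of_nonDerivableSurplus_eq_empty h2
  rw [closureFidelity, h, jaccard_self]

/-! ### Memoryless extensions and mutual information -/

theorem MarkovKernel.memoryless_nonneg {X Y : Type*} [Fintype Y] (W : MarkovKernel X Y) {n : ℕ}
    (x : Fin n → X) (y : Fin n → Y) : 0 ≤ W.memoryless x y :=
  Finset.prod_nonneg fun _ _ => W.nonneg _ _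

theorem MarkovKernel.sum_memoryless {X Y : Type*} [Fintype Y] (W : MarkovKernel X Y) {n : ℕ}
    (x : Fin n → X) : ∑ y, W.memoryless x y = 1 := by
  classical
  simp only [memoryless]
  rw [← Fintype.prod_sum fun k t => W.prob (x k) t]
  simp [W.sum_eq_one]

/-- Output distribution of the channel `W` for the input weights `p`. -/
noncomputable def MarkovKernel.output {X Y : Type*} [Fintype X] [Fintype Y] (W : MarkovKernel X Y)
    (p : X → ℝ) (y : Y) : ℝ :=
  ∑ x, p x * W.prob x y

theorem MarkovKernel.output_nonneg {X Y : Type*} [Fintype X] [Fintype Y] (W : MarkovKernel X Y)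
    {p : X → ℝ} (hp : ∀ x, 0 ≤ p x) (y : Y) : 0 ≤ W.output p y :=
  Finset.sum_nonneg fun x _ => mul_nonneg (hp x) (W.nonneg x y)

theorem MarkovKernel.sum_output {X Y : Type*} [Fintype X] [Fintype Y] (W : MarkovKernel X Y)
    (p : X → ℝ) : ∑ y, W.output p y = ∑ x, p x := by
  simp only [output]
  rw [Finset.sum_comm]
  simp [← Finset.mul_sum, W.sum_eq_one]

theorem MarkovKernel.mul_prob_le_output {X Y : Type*} [Fintype X] [Fintype Y]
    (W : MarkovKernel X Y) {p : X → ℝ} (hp : ∀ x, 0 ≤ p x) (x : X) (y : Y) :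
    p x * W.prob x y ≤ W.output p y :=
  Finset.single_le_sum (f := fun x => p x * W.prob x y)
    (fun x _ => mul_nonneg (hp x) (W.nonneg x y)) (Finset.mem_univ x)

theorem MarkovKernel.mutualInfo_mul_log_two {X Y : Type*} [Fintype X] [Fintype Y]
    (W : MarkovKernel X Y) (p : X → ℝ) :
    (mutualInfo fun x y => p x * W.prob x y) * Real.log 2 =
      ∑ x, ∑ y, p x * W.prob x y * Real.log (W.prob x y / W.output p y) := by
  have hl : Real.log 2 ≠ 0 := (Real.log_pos one_lt_two).ne'
  rw [mutualInfo, Finset.sum_mul]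
  refine Finset.sum_congr rfl fun x _ => ?_
  rw [Finset.sum_mul]
  refine Finset.sum_congr rfl fun y _ => ?_
  rw [← Finset.mul_sum, W.sum_eq_one, mul_one, mul_assoc, Real.logb, div_mul_cancel₀ _ hl]
  by_cases hp : p x = 0
  · simp [hp]
  · rw [mul_div_mul_left _ _ hp]
    rfl

/-- An unbounded real supremum is 0 by convention, so positivity of the capacity already forces
boundedness, without any entropy estimate. -/
theorem MarkovKernel.bddAbove_of_capacity_pos {X Y : Type*} [Fintype X] [Fintype Y]
    {W : MarkovKernel X Y} (hC : 0 < W.capacity) :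
    BddAbove (Set.range fun p : stdSimplex ℝ X =>
      mutualInfo fun x y => (p : X → ℝ) x * W.prob x y) := by
  by_contra h
  exact hC.ne' (Real.iSup_of_not_bddAbove h)

theorem MarkovKernel.mutualInfo_le_capacity {X Y : Type*} [Fintype X] [Fintype Y]
    {W : MarkovKernel X Y} (hC : 0 < W.capacity) {p : X → ℝ} (hp : ∀ x, 0 ≤ p x)
    (hp1 : ∑ x, p x = 1) : (mutualInfo fun x y => p x * W.prob x y) ≤ W.capacity :=
  le_ciSup (bddAbove_of_capacity_pos hC) (⟨p, hp, hp1⟩ : stdSimplex ℝ X)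

theorem MarkovKernel.nonempty_stdSimplex_of_capacity_pos {X Y : Type*} [Fintype X] [Fintype Y]
    {W : MarkovKernel X Y} (hC : 0 < W.capacity) : Nonempty (stdSimplex ℝ X) := by
  by_contra h
  rw [not_nonempty_iff] at h
  exact hC.ne' (Real.iSup_of_isEmpty _)

theorem MarkovKernel.nonempty_of_capacity_pos {X Y : Type*} [Fintype X] [Fintype Y]
    {W : MarkovKernel X Y} (hC : 0 < W.capacity) : Nonempty X := by
  obtain ⟨p⟩ := nonempty_stdSimplex_of_capacity_pos hC
  by_contra h
  rw [not_nonempty_iff] at h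
  simpa using p.2.2

/-! ### Channel coding: achievability -/

/-- Chernoff bound: the probability that an i.i.d. sum of positive mean is nonpositive decays
exponentially. -/
theorem exists_sum_prod_le_pow {Z : Type*} [Fintype Z] {P f : Z → ℝ} (hP : ∀ z, 0 ≤ P z)
    (hP1 : ∑ z, P z = 1) (hf : 0 < ∑ z, P z * f z) :
    ∃ ρ : ℝ, 0 ≤ ρ ∧ ρ < 1 ∧ ∀ n : ℕ,
      ∑ z : Fin n → Z, (if ∑ k, f (z k) ≤ 0 then ∏ k, P (z k) else 0) ≤ ρ ^ n := by
  classical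
  -- The moment generating function equals 1 at 0 with negative slope, so it is below 1 at some s >
  -- 0; that value is ρ.
  have hder : HasDerivAt (fun s : ℝ => ∑ z, P z * Real.exp (-s * f z)) (-∑ z, P z * f z) 0 := by
    rw [← Finset.sum_neg_distrib]
    refine HasDerivAt.fun_sum fun z _ => ?_
    have h := ((((hasDerivAt_id (0 : ℝ)).neg).mul_const (f z)).exp).const_mul (P z)
    simpa using h
  obtain ⟨s, hs, hs1⟩ : ∃ s : ℝ, 0 < s ∧ ∑ z, P z * Real.exp (-s * f z) < 1 := by
    have hslope := (hasDerivAt_iff_tendsto_slope.1 hder).mono_left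
      (nhdsWithin_mono (0 : ℝ) fun s (hs : s ∈ Set.Ioi 0) => ne_of_gt hs)
    have hev := hslope.eventually (gt_mem_nhds (neg_lt_zero.2 hf))
    obtain ⟨s, hs, hs0⟩ := (hev.and (self_mem_nhdsWithin : Set.Ioi (0 : ℝ) ∈ 𝓝[>] 0)).exists
    refine ⟨s, hs0, ?_⟩
    have hs0' : (0 : ℝ) < s := hs0
    rw [slope_def_field, sub_zero, div_neg_iff] at hs
    rcases hs with h | h
    · exact absurd h.2 hs0'.not_gt
    · simpa [hP1] using h.1
  refine ⟨_, Finset.sum_nonneg fun z _ => mul_nonneg (hP z) (Real.exp_pos _).le, hs1,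
    fun n => ?_⟩
  -- Expanding ρ^n over sequences gives the exponential moment of the sum; the exponential factor is
  -- at least 1 wherever the sum is nonpositive.
  rw [Fintype.sum_pow]
  refine Finset.sum_le_sum fun z _ => ?_
  rw [Finset.prod_mul_distrib, ← Real.exp_sum, ← Finset.mul_sum]
  have hnn : 0 ≤ ∏ k, P (z k) := Finset.prod_nonneg fun k _ => hP _
  split_ifs with h
  · refine le_mul_of_one_le_right hnn (Real.one_le_exp ?_)
    nlinarith
  · positivity

/-- Feinstein's lemma: a greedy choice of codewords with disjoint decoding sets. -/
theorem exists_codebook {A B ι : Type*} [Fintype A] [Fintype B] {p : A → ℝ}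
    {V : A → B → ℝ} (hp : ∀ a, 0 ≤ p a) (hp1 : ∑ a, p a = 1) (hV : ∀ a b, 0 ≤ V a b)
    (hV1 : ∀ a, ∑ b, V a b = 1) {t ε M : ℝ} (ht : 0 < t)
    (hε : (∑ a, ∑ b, if V a b ≤ t * ∑ a', p a' * V a' b then p a * V a b else 0) + M / t ≤ ε)
    (s : Finset ι) (hs : (s.card : ℝ) ≤ M) :
    ∃ (enc : ι → A) (D : ι → Finset B),
      (∀ i ∈ s, 1 - ε ≤ ∑ b ∈ D i, V (enc i) b) ∧
      (∀ i ∈ s, ∑ b ∈ D i, ∑ a, p a * V a b ≤ 1 / t) ∧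
      (∀ i ∈ s, ∀ j ∈ s, i ≠ j → Disjoint (D i) (D j)) := by
  classical
  have hA : Nonempty A := by
    by_contra h
    rw [not_nonempty_iff] at h
    simp at hp1
  induction s using Finset.induction_on with
  | empty => exact ⟨fun _ => hA.some, fun _ => ∅, by simp, by simp, by simp⟩
  | insert i s his ih =>
    rw [Finset.card_insert_of_notMem his, Nat.cast_add, Nat.cast_one] at hs
    obtain ⟨enc, D, h1, h2, h3⟩ := ih (by linarith)
    set q : B → ℝ := fun b => ∑ a, p a * V a b with hq
    set E : Finset B := s.biUnion D with hE
    have hqE : ∑ b ∈ E, q b ≤ s.card / t := by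
      rw [hE, Finset.sum_biUnion fun i hi j hj hij => h3 i hi j hj hij]
      refine (Finset.sum_le_sum h2).trans_eq ?_
      rw [Finset.sum_const, nsmul_eq_mul, mul_one_div]
    -- Averaging: if every input failed, the p-mean of the good mass would be at most 1 - ε, while
    -- low density and the used set `E` together remove less than ε.
    obtain ⟨x, hx⟩ : ∃ x, 1 - ε ≤ ∑ b with t * q b < V x b ∧ b ∉ E, V x b := by
      by_contra! hcon
      have hup : ∑ a, p a * ∑ b with t * q b < V a b ∧ b ∉ E, V a b ≤ 1 - ε := by
        calc _ ≤ ∑ a, p a * (1 - ε) :=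
              Finset.sum_le_sum fun a _ => mul_le_mul_of_nonneg_left (hcon a).le (hp a)
          _ = 1 - ε := by rw [← Finset.sum_mul, hp1, one_mul]
      have hlow : ∀ a, p a * 1 ≤ p a * (∑ b with t * q b < V a b ∧ b ∉ E, V a b) +
          (∑ b, if V a b ≤ t * q b then p a * V a b else 0) + ∑ b ∈ E, p a * V a b := by
        intro a
        rw [← hV1 a, ← Finset.sum_filter_add_sum_filter_not Finset.univ (· ∈ E) (V a ·),
          Finset.filter_mem_eq_inter, Finset.univ_inter, mul_add, Finset.mul_sum E,
          add_comm]
        refine add_le_add_left ?_ _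
        rw [Finset.sum_filter, Finset.sum_filter, Finset.mul_sum, Finset.mul_sum,
          ← Finset.sum_add_distrib]
        refine Finset.sum_le_sum fun b _ => ?_
        have := mul_nonneg (hp a) (hV a b)
        by_cases hbE : b ∈ E <;> by_cases hb : V a b ≤ t * q b <;>
          simp [hbE, hb, not_lt.2, lt_of_not_ge, this]
      have hsum := Finset.sum_le_sum fun a (_ : a ∈ Finset.univ) => hlow a
      simp only [mul_one, Finset.sum_add_distrib, hp1] at hsum
      rw [Finset.sum_comm (s := Finset.univ) (t := E)] at hsum
      -- The strict inequality of the contradiction: one codeword is still missing, so `s.card + 1 ≤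
      -- M`.
      have hst : s.card / t < M / t := by
        rw [div_lt_div_iff_of_pos_right ht]
        linarith
      linarith
    have hdis : ∀ j ∈ s, Disjoint (Finset.univ.filter fun b => t * q b < V x b ∧ b ∉ E) (D j) := by
      intro j hj
      rw [Finset.disjoint_left]
      intro b hb hbj
      exact (Finset.mem_filter.1 hb).2.2 (Finset.mem_biUnion.2 ⟨j, hj, hbj⟩)
    have hne : ∀ j ∈ s, j ≠ i := fun j hj h => his (h ▸ hj)
    refine ⟨Function.update enc i x,
      Function.update D i (Finset.univ.filter fun b => t * q b < V x b ∧ b ∉ E), ?_, ?_, ?_⟩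
    · intro j hj
      rcases Finset.mem_insert.1 hj with rfl | hj
      · simpa using hx
      · simpa [Function.update_of_ne (hne j hj)] using h1 j hj
    · intro j hj
      rcases Finset.mem_insert.1 hj with rfl | hj
      · rw [Function.update_self, le_div_iff₀' ht, Finset.mul_sum]
        calc _ ≤ ∑ b with t * q b < V x b ∧ b ∉ E, V x b :=
              Finset.sum_le_sum fun b hb => (Finset.mem_filter.1 hb).2.1.le
          _ ≤ ∑ b, V x b := Finset.sum_le_sum_of_subset_of_nonneg (Finset.subset_univ _)
              fun b _ _ => hV x b
          _ = 1 := hV1 x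
      · rw [Function.update_of_ne (hne j hj)]
        exact h2 j hj
    · intro j hj k hk hjk
      rcases Finset.mem_insert.1 hj with rfl | hjs <;> rcases Finset.mem_insert.1 hk with rfl | hks
      · exact absurd rfl hjk
      · rw [Function.update_self, Function.update_of_ne (hne k hks)]
        exact hdis k hks
      · rw [Function.update_self, Function.update_of_ne (hne j hjs)]
        exact (hdis j hjs).symm
      · rw [Function.update_of_ne (hne j hjs), Function.update_of_ne (hne k hks)]
        exact h3 j hjs k hks hjk

theorem MarkovKernel.sum_prod_mul_memoryless {X Y : Type*} [Fintype X] [Fintype Y]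
    (W : MarkovKernel X Y) (p : X → ℝ) {n : ℕ} (y : Fin n → Y) :
    ∑ x : Fin n → X, (∏ k, p (x k)) * W.memoryless x y = ∏ k, W.output p (y k) := by
  classical
  simp only [memoryless, output, ← Finset.prod_mul_distrib]
  rw [Fintype.prod_sum fun k x => p x * W.prob x (y k)]

/-- The information density of the memoryless extension exceeds `n c` outside a set of
exponentially small probability, for every `c` below the mutual information (in nats). -/
theorem MarkovKernel.exists_sum_memoryless_le_pow {X Y : Type*} [Fintype X] [Fintype Y]
    (W : MarkovKernel X Y) {p : X → ℝ} (hp : ∀ x, 0 ≤ p x) (hp1 : ∑ x, p x = 1) {c : ℝ}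
    (hc : c < (mutualInfo fun x y => p x * W.prob x y) * Real.log 2) :
    ∃ ρ : ℝ, 0 ≤ ρ ∧ ρ < 1 ∧ ∀ n : ℕ,
      (∑ x : Fin n → X, ∑ y : Fin n → Y,
        if W.memoryless x y ≤ Real.exp c ^ n * ∏ k, W.output p (y k)
          then (∏ k, p (x k)) * W.memoryless x y else 0) ≤ ρ ^ n := by
  classical
  set P : X × Y → ℝ := fun z => p z.1 * W.prob z.1 z.2 with hPdef
  have hP : ∀ z, 0 ≤ P z := fun z => mul_nonneg (hp _) (W.nonneg _ _)
  have hP1 : ∑ z, P z = 1 := by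
    rw [Fintype.sum_prod_type]
    simp [hPdef, ← Finset.mul_sum, W.sum_eq_one, hp1]
  have hf : 0 < ∑ z, P z * (Real.log (W.prob z.1 z.2 / W.output p z.2) - c) := by
    simp only [mul_sub, Finset.sum_sub_distrib, ← Finset.sum_mul, hP1, one_mul]
    rw [Fintype.sum_prod_type, sub_pos]
    rwa [W.mutualInfo_mul_log_two] at hc
  obtain ⟨ρ, h0, h1, hρ⟩ := exists_sum_prod_le_pow hP hP1 hf
  refine ⟨ρ, h0, h1, fun n => le_trans ?_ (hρ n)⟩
  rw [← Fintype.sum_prod_type',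
    ← (Equiv.arrowProdEquivProdArrow (Fin n) (fun _ => X) (fun _ => Y)).sum_comp]
  refine Finset.sum_le_sum fun z _ => ?_
  have hz : (∏ k, p (z k).1) * W.memoryless (fun k => (z k).1) (fun k => (z k).2) =
      ∏ k, P (z k) := by
    simp only [memoryless, hPdef, Finset.prod_mul_distrib]
  have hnn : 0 ≤ ∏ k, P (z k) := Finset.prod_nonneg fun k _ => hP _
  simp only [Equiv.arrowProdEquivProdArrow_apply, hz]
  split_ifs with h h' h'
  · rfl
  -- Outside the Chernoff event the weight must vanish. Were it positive, every factor would be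
  -- positive, and taking logarithms of `h` would put the sequence in that event.
  · refine (not_lt.1 fun hpos => h' ?_)
    have hPk : ∀ k, 0 < P (z k) := fun k => (hP _).lt_of_ne'
      ((Finset.prod_ne_zero_iff.1 hpos.ne') k (Finset.mem_univ k))
    have hW : ∀ k, 0 < W.prob (z k).1 (z k).2 := fun k =>
      (W.nonneg _ _).lt_of_ne' fun h => (hPk k).ne' (by simp [hPdef, h])
    have hQ : ∀ k, 0 < W.output p (z k).2 := fun k =>
      (hPk k).trans_le (W.mul_prob_le_output hp _ _)
    have hlog := Real.log_le_log (Finset.prod_pos fun k _ => hW k) h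
    rw [Real.log_mul (by positivity) (Finset.prod_pos fun k _ => hQ k).ne', Real.log_pow,
      Real.log_exp, Real.log_prod fun k _ => (hW k).ne',
      Real.log_prod fun k _ => (hQ k).ne'] at hlog
    have : ∀ k, Real.log (W.prob (z k).1 (z k).2 / W.output p (z k).2) - c =
        Real.log (W.prob (z k).1 (z k).2) - Real.log (W.output p (z k).2) - c := fun k => by
      rw [Real.log_div (hW k).ne' (hQ k).ne']
    simp only [this, Finset.sum_sub_distrib, Finset.sum_const, Finset.card_univ, Fintype.card_fin,
      nsmul_eq_mul]
    linarith
  · exact hnn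
  · rfl

/-- Channel coding theorem: at rates below capacity there are codes of vanishing maximal error. -/
theorem MarkovKernel.exists_code_of_lt_capacity {X Y : Type*} [Fintype X] [Fintype Y]
    {W : MarkovKernel X Y} (hC : 0 < W.capacity) {R δ : ℝ} (hR : R < W.capacity) (hδ : 0 < δ) :
    ∃ N : ℕ, ∀ n ≥ N, ∀ (ι : Type u) [Fintype ι] [Nonempty ι],
      Real.logb 2 (Fintype.card ι) ≤ n * R →
      ∃ (enc : ι → Fin n → X) (D : ι → Finset (Fin n → Y)),
        (∀ i, 1 - δ ≤ ∑ y ∈ D i, W.memoryless (enc i) y) ∧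
        ∀ i j, i ≠ j → Disjoint (D i) (D j) := by
  have := nonempty_stdSimplex_of_capacity_pos hC
  obtain ⟨⟨p, hp, hp1⟩, hI⟩ := exists_lt_of_lt_ciSup hR
  -- The gap below γ makes |ι|/t decay when t = 2^(nγ); the gap above it feeds the Chernoff bound.
  obtain ⟨γ, hRγ, hγI⟩ := exists_between hI
  have hl : 0 < Real.log 2 := Real.log_pos one_lt_two
  obtain ⟨ρ, hρ0, hρ1, hρ⟩ := W.exists_sum_memoryless_le_pow hp hp1
    (mul_lt_mul_of_pos_right hγI hl)
  have hr1 : Real.exp ((R - γ) * Real.log 2) < 1 :=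
    Real.exp_lt_one_iff.2 (mul_neg_of_neg_of_pos (sub_neg.2 hRγ) hl)
  have htend : Tendsto (fun n : ℕ => ρ ^ n + Real.exp ((R - γ) * Real.log 2) ^ n) atTop (𝓝 0) := by
    simpa using (tendsto_pow_atTop_nhds_zero_of_lt_one hρ0 hρ1).add
      (tendsto_pow_atTop_nhds_zero_of_lt_one (Real.exp_pos _).le hr1)
  obtain ⟨N, hN⟩ := eventually_atTop.1 (htend.eventually (gt_mem_nhds hδ))
  refine ⟨N, fun n hn ι _ _ hι => ?_⟩
  have hcard : (0 : ℝ) < Fintype.card ι := by exact_mod_cast Fintype.card_pos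
  have hcard' : (Fintype.card ι : ℝ) ≤ Real.exp (n * (R * Real.log 2)) := by
    rw [← Real.log_le_iff_le_exp hcard, ← mul_assoc, ← div_le_iff₀ hl]
    exact hι
  have hdiv : (Fintype.card ι : ℝ) / Real.exp (γ * Real.log 2) ^ n ≤
      Real.exp ((R - γ) * Real.log 2) ^ n := by
    rw [div_le_iff₀ (by positivity), ← Real.exp_nat_mul, ← Real.exp_nat_mul, ← Real.exp_add]
    refine hcard'.trans_eq (congrArg _ ?_)
    ring
  obtain ⟨enc, D, h1, -, h3⟩ := exists_codebook (ι := ι) (V := W.memoryless (n := n))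
    (p := fun x : Fin n → X => ∏ k, p (x k)) (t := Real.exp (γ * Real.log 2) ^ n)
    (ε := δ) (M := Fintype.card ι)
    (fun x => Finset.prod_nonneg fun k _ => hp _)
    (by rw [← Fintype.sum_pow, hp1, one_pow]) W.memoryless_nonneg W.sum_memoryless
    (by positivity)
    (by
      simp only [W.sum_prod_mul_memoryless]
      have := hρ n
      have := hN n hn
      linarith) Finset.univ (by simp)
  exact ⟨enc, D, fun i => h1 i (Finset.mem_univ i),
    fun i j => h3 i (Finset.mem_univ i) j (Finset.mem_univ j)⟩

/-! ### Channel coding: converse -/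

theorem sum_prod_mul_apply {Y : Type*} [Fintype Y] {n : ℕ} {w : Fin n → Y → ℝ}
    (hw : ∀ k, ∑ t, w k t = 1) (k : Fin n) (h : Y → ℝ) :
    ∑ y : Fin n → Y, (∏ j, w j (y j)) * h (y k) = ∑ t, w k t * h t := by
  classical
  have hprod : ∀ y : Fin n → Y, (∏ j, w j (y j)) * h (y k) =
      ∏ j, w j (y j) * (if j = k then h (y j) else 1) := fun y => by
    rw [Finset.prod_mul_distrib, Finset.prod_ite_eq' Finset.univ k fun j => h (y j),
      if_pos (Finset.mem_univ k)]
  simp only [hprod]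
  rw [← Fintype.prod_sum fun j t => w j t * (if j = k then h t else 1),
    Finset.prod_eq_single k (fun j _ hj => by simp [hj, hw]) (by simp)]
  simp

/-- Gibbs' inequality, pointwise. -/
theorem sub_mul_le_mul_log_div_sub {a b g : ℝ} (ha : 0 ≤ a) (hb : 0 ≤ b) (hab : b = 0 → a = 0)
    (hg : 0 < g) : a - b * g ≤ a * Real.log (a / b) - a * Real.log g := by
  rcases ha.eq_or_lt with rfl | ha
  · simpa using mul_nonneg hb hg.le
  · have hb : 0 < b := hb.lt_of_ne' fun h => ha.ne' (hab h)
    have h := Real.log_le_sub_one_of_pos (x := b * g / a) (by positivity)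
    rw [Real.log_div (by positivity) ha.ne', Real.log_mul hb.ne' hg.ne'] at h
    rw [Real.log_div ha.ne' hb.ne']
    have h' := mul_le_mul_of_nonneg_left h ha.le
    have : a * (b * g / a - 1) = b * g - a := by field_simp
    linarith

/-- Empirical distribution of the `k`-th letter of a codebook. -/
noncomputable def letterDist {X ι : Type*} [Fintype ι] {n : ℕ} (enc : ι → Fin n → X) (k : Fin n)
    (x : X) : ℝ :=
  open Classical in ∑ i, if enc i k = x then (Fintype.card ι : ℝ)⁻¹ else 0

theorem letterDist_nonneg {X ι : Type*} [Fintype ι] {n : ℕ} (enc : ι → Fin n → X) (k : Fin n)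
    (x : X) : 0 ≤ letterDist enc k x := by
  classical
  refine Finset.sum_nonneg fun i _ => ?_
  split_ifs <;> positivity

theorem sum_letterDist_mul {X ι : Type*} [Fintype X] [Fintype ι] {n : ℕ} (enc : ι → Fin n → X)
    (k : Fin n) (h : X → ℝ) :
    ∑ x, letterDist enc k x * h x = ∑ i, (Fintype.card ι : ℝ)⁻¹ * h (enc i k) := by
  classical
  simp only [letterDist, Finset.sum_mul]
  rw [Finset.sum_comm]
  refine Finset.sum_congr rfl fun i _ => ?_
  simp [ite_mul]

theorem sum_letterDist {X ι : Type*} [Fintype X] [Fintype ι] [Nonempty ι] {n : ℕ}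
    (enc : ι → Fin n → X) (k : Fin n) : ∑ x, letterDist enc k x = 1 := by
  simpa using sum_letterDist_mul enc k fun _ => 1

/-- Each letter in use has empirical mass at least 1/|ι|. This is the absolute continuity needed to
split logarithms and to apply Gibbs' inequality. -/
theorem MarkovKernel.prob_eq_zero_of_output_letterDist {X Y ι : Type*} [Fintype X] [Fintype Y]
    [Fintype ι] (W : MarkovKernel X Y) {n : ℕ} (enc : ι → Fin n → X) (k : Fin n) (i : ι) {y : Y}
    (h : W.output (letterDist enc k) y = 0) : W.prob (enc i k) y = 0 := by
  have : Nonempty ι := ⟨i⟩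
  rw [output, sum_letterDist_mul enc k fun x => W.prob x y,
    Finset.sum_eq_zero_iff_of_nonneg fun j _ => mul_nonneg (by positivity) (W.nonneg _ _)] at h
  simpa using h i (Finset.mem_univ i)

/-- The letters of a codebook jointly carry at most `n C` bits about the output. -/
theorem MarkovKernel.sum_memoryless_mul_log_le {X Y ι : Type*} [Fintype X] [Fintype Y] [Fintype ι]
    [Nonempty ι] {W : MarkovKernel X Y} (hC : 0 < W.capacity) {n : ℕ} (enc : ι → Fin n → X) :
    ∑ i, ∑ y, W.memoryless (enc i) y *
        Real.log (W.memoryless (enc i) y / ∏ k, W.output (letterDist enc k) (y k)) ≤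
      Fintype.card ι * (n * W.capacity * Real.log 2) := by
  -- The reference measure is a product, not the true block output distribution, so the density
  -- splits letter by letter without subadditivity of entropy.
  have hlog : ∀ i (y : Fin n → Y), W.memoryless (enc i) y *
        Real.log (W.memoryless (enc i) y / ∏ k, W.output (letterDist enc k) (y k)) =
      ∑ k, W.memoryless (enc i) y *
        Real.log (W.prob (enc i k) (y k) / W.output (letterDist enc k) (y k)) := by
    intro i y
    by_cases h : W.memoryless (enc i) y = 0
    · simp [h]
    · have hk : ∀ k, W.prob (enc i k) (y k) ≠ 0 := fun k =>
        Finset.prod_ne_zero_iff.1 h k (Finset.mem_univ k)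
      rw [← Finset.mul_sum, ← Real.log_prod fun k _ => div_ne_zero (hk k) fun h0 =>
        hk k (W.prob_eq_zero_of_output_letterDist enc k i h0), Finset.prod_div_distrib]
      rfl
  have hletter : ∀ k, ∑ i, ∑ t, W.prob (enc i k) t *
      Real.log (W.prob (enc i k) t / W.output (letterDist enc k) t) ≤
        Fintype.card ι * (W.capacity * Real.log 2) := by
    intro k
    have hle := mutualInfo_le_capacity hC (letterDist_nonneg enc k) (sum_letterDist enc k)
    have hle' := mul_le_mul_of_nonneg_right hle (Real.log_pos one_lt_two).le
    simp only [W.mutualInfo_mul_log_two, mul_assoc, ← Finset.mul_sum] at hle'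
    rw [sum_letterDist_mul enc k fun x => ∑ t, W.prob x t *
      Real.log (W.prob x t / W.output (letterDist enc k) t), ← Finset.mul_sum,
      inv_mul_le_iff₀ (by positivity)] at hle'
    exact hle'
  calc _ = ∑ k, ∑ i, ∑ t, W.prob (enc i k) t *
      Real.log (W.prob (enc i k) t / W.output (letterDist enc k) t) := by
        rw [Finset.sum_comm (s := (Finset.univ : Finset (Fin n)))]
        refine Finset.sum_congr rfl fun i _ => ?_
        simp only [hlog]
        rw [Finset.sum_comm]
        exact Finset.sum_congr rfl fun k _ =>
          sum_prod_mul_apply (w := fun k t => W.prob (enc i k) t) (fun k => W.sum_eq_one _) k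
            fun t => Real.log (W.prob (enc i k) t / W.output (letterDist enc k) t)
    _ ≤ ∑ _k : Fin n, Fintype.card ι * (W.capacity * Real.log 2) :=
        Finset.sum_le_sum fun k _ => hletter k
    _ = _ := by
        rw [Finset.sum_const, Finset.card_univ, Fintype.card_fin, nsmul_eq_mul]
        ring

/-- Fano's converse for codes with disjoint decoding sets. -/
theorem MarkovKernel.one_sub_mul_logb_card_le {X Y ι : Type*} [Fintype X] [Fintype Y] [Fintype ι]
    [Nonempty ι] {W : MarkovKernel X Y} (hC : 0 < W.capacity) {n : ℕ} (enc : ι → Fin n → X)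
    (D : ι → Finset (Fin n → Y)) (hD : ∀ i j, i ≠ j → Disjoint (D i) (D j)) {ε : ℝ}
    (hε : ∀ i, 1 - ε ≤ ∑ y ∈ D i, W.memoryless (enc i) y) :
    (1 - ε) * Real.logb 2 (Fintype.card ι) ≤ n * W.capacity + 1 := by
  classical
  set M : ℝ := (Fintype.card ι : ℝ) with hMdef
  have hM1 : 1 ≤ M := Nat.one_le_cast.2 Fintype.card_pos
  have hM : 0 < M := one_pos.trans_le hM1
  set Q : (Fin n → Y) → ℝ := fun y => ∏ k, W.output (letterDist enc k) (y k) with hQ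
  have hQ0 : ∀ y, 0 ≤ Q y := fun y =>
    Finset.prod_nonneg fun k _ => W.output_nonneg (letterDist_nonneg enc k) _
  have hQ1 : ∑ y, Q y = 1 := by
    rw [hQ, ← Fintype.prod_sum fun k t => W.output (letterDist enc k) t]
    simp [W.sum_output, sum_letterDist]
  have hac : ∀ i y, Q y = 0 → W.memoryless (enc i) y = 0 := fun i y h => by
    obtain ⟨k, hk, hk0⟩ := Finset.prod_eq_zero_iff.1 h
    exact Finset.prod_eq_zero hk (W.prob_eq_zero_of_output_letterDist enc k i hk0)
  -- Test function for Gibbs' inequality: by disjointness its sum over i is at most M/2 + M/2. Its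
  -- logarithm is log M on `D i` and 0 elsewhere, minus log 2; this log 2 is the final +1 bit.
  set g : ι → (Fin n → Y) → ℝ := fun i y => (if y ∈ D i then M else 1) / 2 with hg
  have hg0 : ∀ i y, 0 < g i y := fun i y => by
    simp only [hg]
    split_ifs <;> positivity
  have hgsum : ∀ y, ∑ i, g i y ≤ M := by
    intro y
    have hcount : ∑ i, (if y ∈ D i then M else 0) ≤ M := by
      by_cases h : ∃ i, y ∈ D i
      · obtain ⟨i, hi⟩ := h
        rw [Finset.sum_eq_single i (fun j _ hj => if_neg fun hyj =>
          Finset.disjoint_left.1 (hD j i hj) hyj hi) (by simp), if_pos hi]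
      · push Not at h
        simp [h, hM.le]
    calc ∑ i, g i y ≤ ∑ i, ((if y ∈ D i then M else 0) + 1) / 2 := by
          refine Finset.sum_le_sum fun i _ => ?_
          simp only [hg]
          split_ifs <;> linarith
      _ = ((∑ i, if y ∈ D i then M else 0) + M) / 2 := by
          rw [← Finset.sum_div, Finset.sum_add_distrib]
          simp [hMdef]
      _ ≤ M := by linarith
  have hgibbs : ∑ i, ∑ y, W.memoryless (enc i) y * Real.log (g i y) ≤
      ∑ i, ∑ y, W.memoryless (enc i) y * Real.log (W.memoryless (enc i) y / Q y) := by
    have h := Finset.sum_le_sum fun i (_ : i ∈ Finset.univ) =>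
      Finset.sum_le_sum fun y (_ : y ∈ Finset.univ) =>
        sub_mul_le_mul_log_div_sub (W.memoryless_nonneg (enc i) y) (hQ0 y) (hac i y) (hg0 i y)
    simp only [Finset.sum_sub_distrib, W.sum_memoryless] at h
    have h2 : ∑ i, ∑ y, Q y * g i y ≤ M := by
      rw [Finset.sum_comm]
      calc _ ≤ ∑ y, Q y * M := Finset.sum_le_sum fun y _ => by
            rw [← Finset.mul_sum]
            exact mul_le_mul_of_nonneg_left (hgsum y) (hQ0 y)
        _ = M := by rw [← Finset.sum_mul, hQ1, one_mul]
    have h3 : ∑ _i : ι, (1 : ℝ) = M := by simp [hMdef]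
    linarith
  have hlow : ∀ i, (1 - ε) * Real.log M - Real.log 2 ≤
      ∑ y, W.memoryless (enc i) y * Real.log (g i y) := by
    intro i
    have : ∀ y, W.memoryless (enc i) y * Real.log (g i y) =
        (if y ∈ D i then W.memoryless (enc i) y else 0) * Real.log M -
          W.memoryless (enc i) y * Real.log 2 := by
      intro y
      simp only [hg]
      split_ifs
      · rw [Real.log_div hM.ne' two_ne_zero, mul_sub]
      · rw [Real.log_div one_ne_zero two_ne_zero, Real.log_one, mul_sub]
        ring
    simp only [this]
    rw [Finset.sum_sub_distrib, ← Finset.sum_mul, ← Finset.sum_mul, W.sum_memoryless, one_mul,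
      ← Finset.sum_filter, Finset.filter_mem_eq_inter, Finset.univ_inter]
    exact sub_le_sub_right (mul_le_mul_of_nonneg_right (hε i) (Real.log_nonneg hM1)) _
  have hl : 0 < Real.log 2 := Real.log_pos one_lt_two
  have hsum := (Finset.sum_le_sum fun i (_ : i ∈ Finset.univ) => hlow i).trans
    (hgibbs.trans (sum_memoryless_mul_log_le hC enc))
  rw [Finset.sum_const, Finset.card_univ, nsmul_eq_mul] at hsum
  have hfin := le_of_mul_le_mul_left hsum hM
  rw [Real.logb, ← mul_div_assoc, div_le_iff₀ hl]
  linarith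

/-! ### Closure error of semantic block codes -/

open Classical in
theorem BlockCode.closureError_le {U X Y : Type*} [Fintype Y] {n : ℕ} {M V : Finset U}
    {c : BlockCode n X Y M V} {PS : ProofSystem U} {Γ : Finset U} {W : MarkovKernel X Y} {δ : ℝ}
    (hδ : 0 ≤ δ) (h : ∀ m : M, (∑ y : Fin n → Y,
      if 0 < PS.closureDistortion Γ m (c.dec y) then W.memoryless (c.enc m) y else 0) ≤ δ) :
    c.closureError PS Γ W ≤ δ :=
  Real.iSup_le h hδ

theorem BlockCode.closureError_nonneg {U X Y : Type*} [Fintype Y] {n : ℕ} {M V : Finset U}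
    (c : BlockCode n X Y M V) (PS : ProofSystem U) (Γ : Finset U) (W : MarkovKernel X Y) :
    0 ≤ c.closureError PS Γ W := by
  classical
  refine Real.iSup_nonneg fun m => Finset.sum_nonneg fun y _ => ?_
  split_ifs
  · exact W.memoryless_nonneg _ _
  · rfl

theorem BlockCode.one_sub_closureError_le {U X Y : Type*} [Finite U] [Fintype Y] {n : ℕ}
    {M V : Finset U} (c : BlockCode n X Y M V) (PS : ProofSystem U) (Γ : Finset U)
    (W : MarkovKernel X Y) (m : M) [DecidablePred fun y => PS.closureDistortion Γ m (c.dec y) = 0] :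
    1 - c.closureError PS Γ W ≤
      ∑ y with PS.closureDistortion Γ m (c.dec y) = 0, W.memoryless (c.enc m) y := by
  classical
  have h := le_ciSup (f := fun m : M => ∑ y : Fin n → Y,
    if 0 < PS.closureDistortion Γ m (c.dec y) then W.memoryless (c.enc m) y else 0)
    (Set.finite_range _).bddAbove m
  have hsum : (∑ y : Fin n → Y,
      if 0 < PS.closureDistortion Γ m (c.dec y) then W.memoryless (c.enc m) y else 0) +
      ∑ y with PS.closureDistortion Γ m (c.dec y) = 0, W.memoryless (c.enc m) y = 1 := by
    rw [← W.sum_memoryless (c.enc m), Finset.sum_filter, ← Finset.sum_add_distrib]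
    refine Finset.sum_congr rfl fun y _ => ?_
    rcases (PS.closureDistortion_nonneg Γ m (c.dec y)).eq_or_lt with h0 | h0
    · simp [← h0]
    · simp [h0, h0.ne']
  have h' : _ ≤ c.closureError PS Γ W := h
  linarith

/-- A channel code for the core gives a two-layer code whose closure error is at most its maximal
error probability. -/
theorem exists_isTwoLayer_of_code {U X Y : Type*} [Finite U] [LinearOrder U] [Fintype Y]
    {W : MarkovKernel X Y} {PS : ProofSystem U} {Si Sj : Finset U} (h1 : PS.core Si ⊆ Sj)
    (hne : (PS.core Si).Nonempty) {n : ℕ} {δ : ℝ} (hδ : 0 ≤ δ) (enc : PS.core Si → Fin n → X)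
    (D : PS.core Si → Finset (Fin n → Y))
    (hD : ∀ i j, i ≠ j → Disjoint (D i) (D j))
    (herr : ∀ i, 1 - δ ≤ ∑ y ∈ D i, W.memoryless (enc i) y) :
    ∃ c : BlockCode n X Y Si Sj, c.closureError PS Si W ≤ δ ∧ c.IsTwoLayer (PS.core Si) := by
  classical
  obtain ⟨a₀, ha₀⟩ := hne
  -- Outputs in no decoding set go to `a₀`, so the decoder never leaves the core, as non-core
  -- messages require only a consequence of the base.
  set dec : (Fin n → Y) → PS.core Si := fun y =>
    if h : ∃ i, y ∈ D i then h.choose else ⟨a₀, ha₀⟩ with hdec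
  have hdecD : ∀ i, ∀ y ∈ D i, dec y = i := by
    intro i y hy
    have h : ∃ i, y ∈ D i := ⟨i, hy⟩
    simp only [hdec, dif_pos h]
    by_contra hne
    exact Finset.disjoint_left.1 (hD _ _ hne) h.choose_spec hy
  let c : BlockCode n X Y Si Sj :=
    { enc := fun m => if h : (m : U) ∈ PS.core Si then enc ⟨m, h⟩ else enc ⟨a₀, ha₀⟩
      dec := fun y => ⟨dec y, h1 (dec y).2⟩ }
  refine ⟨c, BlockCode.closureError_le hδ fun m => ?_, fun y => (dec y).2,
    ⟨a₀, PS.core_subset Si ha₀⟩, ha₀, fun m hm => ?_⟩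
  · by_cases hm : (m : U) ∈ PS.core Si
    · have henc : c.enc m = enc ⟨m, hm⟩ := dif_pos hm
      have hsplit := W.sum_memoryless (enc ⟨m, hm⟩)
      rw [← Finset.sum_add_sum_compl (D ⟨m, hm⟩)] at hsplit
      have hle : (∑ y : Fin n → Y, if 0 < PS.closureDistortion Si m (c.dec y) then
          W.memoryless (c.enc m) y else 0) ≤ ∑ y ∈ (D ⟨m, hm⟩)ᶜ, W.memoryless (enc ⟨m, hm⟩) y := by
        rw [← Finset.sum_filter, henc]
        refine Finset.sum_le_sum_of_subset_of_nonneg (fun y hy => ?_)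
          fun y _ _ => W.memoryless_nonneg _ _
        rw [Finset.mem_compl]
        intro hyD
        have hcd : (c.dec y : U) = m := congrArg Subtype.val (hdecD _ y hyD)
        have hpos := (Finset.mem_filter.1 hy).2
        rw [hcd, PS.closureDistortion_self] at hpos
        exact lt_irrefl _ hpos
      linarith [herr ⟨m, hm⟩]
    · have h0 : ∀ y, PS.closureDistortion Si m (c.dec y) = 0 := fun y =>
        PS.closureDistortion_eq_zero_of_notMem_core m.2 hm
          (PS.subset_Cn _ (PS.core_subset Si (dec y).2))
      simpa [h0] using hδ
  · simp [c, hm, ha₀]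

/-- No core atom is available as output here, so (H2) must guarantee that whatever the receiver
holds is a consequence of the sender's base. -/
theorem BlockCode.closureError_eq_zero_of_core_eq_empty {U X Y : Type*} [Finite U] [LinearOrder U]
    [Fintype Y] {n : ℕ} {PS : ProofSystem U} {Si Sj : Finset U} (c : BlockCode n X Y Si Sj)
    (W : MarkovKernel X Y) (hcore : PS.core Si = ∅) (h2 : (Sj : Set U) ⊆ PS.Cn (Si : Set U)) :
    c.closureError PS Si W = 0 := by
  classical
  refine le_antisymm (closureError_le le_rfl fun m => ?_) (c.closureError_nonneg PS Si W)
  have h0 : ∀ y, PS.closureDistortion Si m (c.dec y) = 0 := fun y =>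
    PS.closureDistortion_eq_zero_of_notMem_core m.2 (by simp [hcore]) (h2 (c.dec y).2)
  simp [h0]

/-- Achievability, uniformly in the universe, the proof system and the pair. -/
theorem exists_blockCode_of_lt_capacity {X : Type v} {Y : Type w} [Fintype X] [Fintype Y]
    {W : MarkovKernel X Y} (hC : 0 < W.capacity) {R δ : ℝ} (hR : R < W.capacity) (hδ : 0 < δ) :
    ∃ N : ℕ, ∀ n ≥ N, ∀ (U : Type u) [Fintype U] [LinearOrder U] (PS : ProofSystem U)
      (Si Sj : Finset U), Sj.Nonempty → PS.lostCore Si Sj = ∅ → PS.nonDerivableSurplus Si Sj = ∅ →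
        Real.logb 2 (PS.core Si).card / n ≤ R →
        ∃ c : BlockCode n X Y Si Sj, c.closureError PS Si W ≤ δ ∧
          ((PS.core Si).Nonempty → c.IsTwoLayer (PS.core Si)) := by
  obtain ⟨N, hN⟩ := MarkovKernel.exists_code_of_lt_capacity.{u} hC hR hδ
  -- At n = 0 the rate quotient is 0 by convention and would not bound the core.
  refine ⟨max N 1, fun n hn U _ _ PS Si Sj hSj h1 h2 hrate => ?_⟩
  have hn0 : (0 : ℝ) < n := by exact_mod_cast (le_max_right N 1).trans hn
  rcases (PS.core Si).eq_empty_or_nonempty with hcore | hcore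
  · obtain ⟨x⟩ := MarkovKernel.nonempty_of_capacity_pos hC
    obtain ⟨s, hs⟩ := hSj
    let c : BlockCode n X Y Si Sj := ⟨fun _ _ => x, fun _ => ⟨s, hs⟩⟩
    refine ⟨c, ?_, fun h => absurd hcore h.ne_empty⟩
    rw [c.closureError_eq_zero_of_core_eq_empty W hcore
      (ProofSystem.subset_Cn_of_nonDerivableSurplus_eq_empty h2)]
    exact hδ.le
  · have : Nonempty (PS.core Si) := hcore.to_subtype
    obtain ⟨enc, D, herr, hD⟩ := hN n ((le_max_left N 1).trans hn) (PS.core Si) (by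
      rw [Fintype.card_coe]
      rwa [div_le_iff₀' hn0] at hrate)
    obtain ⟨c, hc, hc2⟩ := exists_isTwoLayer_of_code
      (ProofSystem.core_subset_of_lostCore_eq_empty h1) hcore hδ.le enc D hD herr
    exact ⟨c, hc, fun _ => hc2⟩

/-- Codes of vanishing error for a fixed pair. -/
theorem exists_blockCode_tendsto_zero {U : Type u} {X : Type v} {Y : Type w} [Fintype U]
    [LinearOrder U] [Fintype X] [Fintype Y] {W : MarkovKernel X Y} (hC : 0 < W.capacity)
    {PS : ProofSystem U} {Si Sj : Finset U} (hSj : Sj.Nonempty) (h1 : PS.lostCore Si Sj = ∅)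
    (h2 : PS.nonDerivableSurplus Si Sj = ∅) :
    ∃ c : (n : ℕ) → BlockCode n X Y Si Sj,
      Tendsto (fun n => (c n).closureError PS Si W) atTop (𝓝 0) ∧
      ((PS.core Si).Nonempty → ∀ n, (c n).IsTwoLayer (PS.core Si)) := by
  classical
  let good (n : ℕ) := {c : BlockCode n X Y Si Sj //
    (PS.core Si).Nonempty → c.IsTwoLayer (PS.core Si)}
  have hgood : ∀ n, Nonempty (good n) := by
    intro n
    obtain ⟨x⟩ := MarkovKernel.nonempty_of_capacity_pos hC
    rcases (PS.core Si).eq_empty_or_nonempty with hcore | ⟨a, ha⟩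
    · obtain ⟨s, hs⟩ := hSj
      exact ⟨⟨fun _ _ => x, fun _ => ⟨s, hs⟩⟩, fun h => absurd hcore h.ne_empty⟩
    · exact ⟨⟨fun _ _ => x, fun _ =>
        ⟨a, ProofSystem.core_subset_of_lostCore_eq_empty h1 ha⟩⟩, fun _ =>
          ⟨fun _ => ha, ⟨a, PS.core_subset Si ha⟩, ha, fun _ _ => rfl⟩⟩
  -- Near-optimal codes at each length form a single sequence that serves every δ at once.
  have hnear : ∀ n : ℕ, ∃ c : good n, c.1.closureError PS Si W <
      (⨅ c : good n, c.1.closureError PS Si W) + 1 / ((n : ℝ) + 1) := fun n =>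
    exists_lt_of_ciInf_lt (lt_add_of_pos_right _ (by positivity))
  choose c hc using hnear
  refine ⟨fun n => (c n).1, ?_, fun h n => (c n).2 h⟩
  rw [Metric.tendsto_atTop]
  intro δ hδ
  -- Any positive rate below capacity would do, since log|A|/n tends to 0 for a fixed core.
  obtain ⟨N, hN⟩ := exists_blockCode_of_lt_capacity.{u} hC (half_lt_self hC) (half_pos hδ)
  have hrate := (tendsto_const_div_atTop_nhds_zero_nat
    (Real.logb 2 (PS.core Si).card)).eventually (gt_mem_nhds (half_pos hC))
  have hone := (tendsto_one_div_add_atTop_nhds_zero_nat (𝕜 := ℝ)).eventually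
    (gt_mem_nhds (half_pos hδ))
  obtain ⟨K, hK⟩ := eventually_atTop.1 ((hrate.and hone).and (eventually_ge_atTop N))
  refine ⟨K, fun n hn => ?_⟩
  obtain ⟨⟨hr, ho⟩, hnN⟩ := hK n hn
  obtain ⟨c', hc', htl⟩ := hN n hnN U PS Si Sj hSj h1 h2 hr.le
  have hinf : (⨅ c : good n, c.1.closureError PS Si W) ≤ δ / 2 :=
    (ciInf_le ⟨0, by rintro _ ⟨d, rfl⟩; exact d.1.closureError_nonneg PS Si W⟩
      (⟨c', htl⟩ : good n)).trans hc'
  rw [Real.dist_0_eq_abs, abs_of_nonneg ((c n).1.closureError_nonneg PS Si W)]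
  linarith [hc n]

/-- Converse for a pair whose core elements have disjoint acceptable sets. -/
theorem logb_card_core_le {U X Y : Type*} [Finite U] [LinearOrder U] [Fintype X] [Fintype Y]
    {W : MarkovKernel X Y} (hC : 0 < W.capacity) {PS : ProofSystem U} {Si Sj : Finset U}
    (hdisj : PS.CoreDisjoint Si Sj) {n : ℕ} {ε : ℝ} (c : BlockCode n X Y Si Sj) (hε : ε < 1)
    (hc : c.closureError PS Si W ≤ ε) :
    Real.logb 2 (PS.core Si).card ≤ (n * W.capacity + 1) / (1 - ε) := by
  classical
  have hε' : 0 < 1 - ε := sub_pos.2 hε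
  rcases (PS.core Si).eq_empty_or_nonempty with hcore | hcore
  · rw [hcore]
    simp only [Finset.card_empty, Nat.cast_zero, Real.logb_zero]
    positivity
  · have : Nonempty (PS.core Si) := hcore.to_subtype
    let msg (a : PS.core Si) : Si := ⟨a, PS.core_subset Si a.2⟩
    -- Restrict the code to core messages; the decoding set of a consists of the channel outputs
    -- decoded into its acceptable set.
    have h := MarkovKernel.one_sub_mul_logb_card_le hC (fun a => c.enc (msg a))
      (fun a => Finset.univ.filter fun y => PS.closureDistortion Si (msg a) (c.dec y) = 0)
      (fun a b hab => by
        rw [Finset.disjoint_left]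
        intro y hya hyb
        exact Set.disjoint_left.1 (hdisj a a.2 b b.2 fun h => hab (Subtype.ext h))
          ⟨(c.dec y).2, (Finset.mem_filter.1 hya).2⟩ ⟨(c.dec y).2, (Finset.mem_filter.1 hyb).2⟩)
      (ε := ε)
      (fun a => (sub_le_sub_left hc 1).trans (c.one_sub_closureError_le PS Si W (msg a)))
    rwa [Fintype.card_coe, ← le_div_iff₀' hε'] at h

end SemComm

theorem mainTheorem9 {X : Type v} {Y : Type w} [Fintype X] [Fintype Y]
    (W : SemComm.MarkovKernel X Y) (hC : 0 < W.capacity) :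
    -- the three claims for a fixed sender-receiver pair
    (∀ (U : Type u) [Fintype U] [LinearOrder U] (PS : SemComm.ProofSystem U) (Si Sj : Finset U),
      Sj.Nonempty →
      PS.lostCore Si Sj = ∅ →
      PS.nonDerivableSurplus Si Sj = ∅ →
      -- (i) set-level closure fidelity
      PS.closureFidelity Si Sj = 1 ∧
      -- (ii) achievability
      (∃ c : (n : ℕ) → SemComm.BlockCode n X Y Si Sj,
        Tendsto (fun n => (c n).closureError PS Si W) atTop (𝓝 0) ∧
        ((PS.core Si).Nonempty → ∀ n, (c n).IsTwoLayer (PS.core Si))) ∧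
      -- (iii) converse
      (PS.CoreDisjoint Si Sj →
        ∀ (n : ℕ) (ε : ℝ) (c : SemComm.BlockCode n X Y Si Sj), ε < 1 →
          c.closureError PS Si W ≤ ε →
          Real.logb 2 (PS.core Si).card ≤ (n * W.capacity + 1) / (1 - ε))) ∧
    -- (ii), rate form: at any rate below capacity the error vanishes, uniformly in the pair
    (∀ R < W.capacity, ∀ δ > 0, ∃ N : ℕ, ∀ n ≥ N,
      ∀ (U : Type u) [Fintype U] [LinearOrder U] (PS : SemComm.ProofSystem U) (Si Sj : Finset U),
        Sj.Nonempty →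
        PS.lostCore Si Sj = ∅ →
        PS.nonDerivableSurplus Si Sj = ∅ →
        Real.logb 2 (PS.core Si).card / n ≤ R →
        ∃ c : SemComm.BlockCode n X Y Si Sj,
          c.closureError PS Si W ≤ δ ∧
          ((PS.core Si).Nonempty → c.IsTwoLayer (PS.core Si))) := by
  refine ⟨fun U _ _ PS Si Sj hSj h1 h2 => ⟨SemComm.ProofSystem.closureFidelity_eq_one h1 h2,
    SemComm.exists_blockCode_tendsto_zero hC hSj h1 h2, fun hdisj n ε c hε hc =>
      SemComm.logb_card_core_le hC hdisj c hε hc⟩, fun R hR δ hδ =>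
    SemComm.exists_blockCode_of_lt_capacity hC hR hδ⟩
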